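/- Let $d\ge 1$, let $\mathbb N=\{0,1,2,\dots\}$, and let $\mu,\mu_0$ be positive measures on $\mathbb Z^d=\mathbb Z^{d-1}\times\mathbb Z$ with $0<\mu(\mathbb Z^d)\le 1$ and $0<\mu_0(\mathbb Z^d)\le 1$. Let $Z=(Z(n))_{n\ge 0}$ be the (possibly substochastic) Markov chain on $\mathbb Z^{d-1}\times\mathbb N$ whose transition kernel $P=(p(z,z'))$ is given, for $z=(x,y)$ and $z'$ in $\mathbb Z^{d-1}\times\mathbb N$, by $p(z,z')=\mu(z'-z)$ if $y>0$ and $p(z,z')=\mu_0(z'-z)$ if $y=0$. Assume: (H0) $\mu(x,y)=0$ whenever $y<-1$, and $\mu_0(x,y)=0$ whenever $y<0$; (H1) $Z$ is irreducible on $\mathbb Z^{d-1}\times\mathbb N$; (H2) the homogeneous random walk on $\mathbb Z^d$ with transition probabilities $p_S(z,z')=\mu(z'-z)$ is irreducible on $\mathbb Z^d$; (H3) the jump generating functions $\varphi(a)=\sum_{z\in\mathbb Z^d}\mu(z)e^{a\cdot z}$ and $\varphi_0(a)=\sum_{z\in\mathbb Z^d}\mu_0(z)e^{a\cdot z}$ are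 finite for every $a\in\mathbb R^d$. Let $\rho(P)$ be the convergence norm of $P$, that is, the infimum of the $t>0$ for which the series $\sum_{n\ge 0}t^{-n}\,\mathbb P_z(Z(n)=z')$ converges. Then, for every choice of $z,z'\in\mathbb Z^{d-1}\times\mathbb N$ in this definition, $$\rho(P)=\inf_{a\in\mathbb R^d}\max\{\varphi(a),\varphi_0(a)\}.$$ -/

import Mathlib

open MeasureTheory
open scoped ENNReal

noncomputable section

namespace HalfSpaceWalk

/-- The `n`-step transition probabilities `ℙ_z(Z(n) = z')` of a (possibly substochastic) transition
kernel `P` on a discrete state space. -/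
def nStep {E : Type*} (P : E → E → ℝ≥0∞) : ℕ → E → E → ℝ≥0∞
  | 0, z, z' => by
      classical
      exact if z = z' then 1 else 0
  | n + 1, z, z' => ∑' w, P z w * nStep P n w z'

/-- Irreducibility: every state is reached from every state with positive probability. -/
def IsIrreducible {E : Type*} (P : E → E → ℝ≥0∞) : Prop :=
  ∀ z z' : E, ∃ n : ℕ, 0 < nStep P n z z'

/-- The Green series `G_t(z, z') = ∑ₙ t⁻ⁿ ℙ_z(Z(n) = z')`. -/
def green {E : Type*} (P : E → E → ℝ≥0∞) (t : ℝ≥0∞) (z z' : E) : ℝ≥0∞ :=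
  ∑' n : ℕ, t⁻¹ ^ n * nStep P n z z'

/-- The convergence norm, computed at the pair `(z, z')`: the infimum of the real numbers `t > 0`
for which the series `G_t(z, z')` converges. (For an irreducible kernel it does not depend on the
pair.) -/
def convergenceNorm {E : Type*} (P : E → E → ℝ≥0∞) (z z' : E) : ℝ≥0∞ :=
  sInf {t : ℝ≥0∞ | 0 < t ∧ t < ∞ ∧ green P t z z' < ∞}

/-- The lattice `ℤ^d = ℤ^(d-1) × ℤ`, where `m = d - 1`. -/
abbrev Lattice (m : ℕ) : Type := (Fin m → ℤ) × ℤ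

/-- The half-space `ℤ^(d-1) × ℕ`, where `m = d - 1`. -/
abbrev HalfSpace (m : ℕ) : Type := (Fin m → ℤ) × ℕ

/-- The inclusion of the half-space into the lattice. -/
def HalfSpace.toLattice {m : ℕ} (z : HalfSpace m) : Lattice m := (z.1, (z.2 : ℤ))

/-- The transition kernel of the walk on the half-space: jumps have law `μ` in the interior
(`y > 0`) and `μ₀` on the boundary (`y = 0`). -/
def kernel {m : ℕ} (μ μ₀ : Measure (Lattice m)) (z z' : HalfSpace m) : ℝ≥0∞ :=
  if 0 < z.2 then μ {z'.toLattice - z.toLattice} else μ₀ {z'.toLattice - z.toLattice}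

/-- The transition kernel of the homogeneous random walk on the lattice with jump law `μ`. -/
def homogeneousKernel {m : ℕ} (μ : Measure (Lattice m)) (z z' : Lattice m) : ℝ≥0∞ :=
  μ {z' - z}

/-- The scalar product `a · z` for `a ∈ ℝ^d = ℝ^(d-1) × ℝ` and `z ∈ ℤ^d`. -/
def dot {m : ℕ} (a : (Fin m → ℝ) × ℝ) (z : Lattice m) : ℝ :=
  (∑ i, a.1 i * (z.1 i : ℝ)) + a.2 * (z.2 : ℝ)

/-- The jump generating function `φ(a) = ∑_z μ(z) exp(a · z)`, with value `∞` if the series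
diverges. -/
def jumpGen {m : ℕ} (μ : Measure (Lattice m)) (a : (Fin m → ℝ) × ℝ) : ℝ≥0∞ :=
  ∑' z : Lattice m, μ {z} * ENNReal.ofReal (Real.exp (dot a z))

end HalfSpaceWalk

end

namespace HalfSpaceWalk

open Filter Topology

/-! ### Invariant means -/

/-- A real function with bounded absolute value. -/
def IsBdd {G : Type*} (u : G → ℝ) : Prop := ∃ C, ∀ x, |u x| ≤ C

theorem IsBdd.add {G : Type*} {u v : G → ℝ} (hu : IsBdd u) (hv : IsBdd v) :
    IsBdd fun x => u x + v x := by
  obtain ⟨C, hC⟩ := hu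
  obtain ⟨D, hD⟩ := hv
  exact ⟨C + D, fun x => (abs_add_le _ _).trans (add_le_add (hC x) (hD x))⟩

theorem IsBdd.const_mul {G : Type*} {u : G → ℝ} (c : ℝ) (hu : IsBdd u) :
    IsBdd fun x => c * u x := by
  obtain ⟨C, hC⟩ := hu
  exact ⟨|c| * C, fun x => by
    rw [abs_mul]; exact mul_le_mul_of_nonneg_left (hC x) (abs_nonneg c)⟩

theorem isBdd_const {G : Type*} (c : ℝ) : IsBdd fun _ : G => c := ⟨|c|, fun _ => le_rfl⟩

theorem IsBdd.comp {G H : Type*} {u : G → ℝ} (hu : IsBdd u) (f : H → G) :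
    IsBdd fun x => u (f x) := by
  obtain ⟨C, hC⟩ := hu
  exact ⟨C, fun x => hC _⟩

theorem IsBdd.sum {G ι : Type*} (s : Finset ι) {u : ι → G → ℝ} (hu : ∀ i ∈ s, IsBdd (u i)) :
    IsBdd fun x => ∑ i ∈ s, u i x := by
  classical
  induction s using Finset.induction_on with
  | empty => simpa using isBdd_const 0
  | insert a s ha ih =>
    simp only [Finset.sum_insert ha]
    exact (hu a (by simp)).add (ih fun i hi => hu i (by simp [hi]))

/-- `M` is a translation invariant mean on the bounded real functions on `G`. -/
structure IsInvariantMean {G : Type*} [AddCommGroup G] (M : (G → ℝ) → ℝ) : Prop where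
  add : ∀ u v : G → ℝ, IsBdd u → IsBdd v → M (fun x => u x + v x) = M u + M v
  const_mul : ∀ (c : ℝ) (u : G → ℝ), IsBdd u → M (fun x => c * u x) = c * M u
  const : ∀ c : ℝ, M (fun _ => c) = c
  mono : ∀ u v : G → ℝ, IsBdd u → IsBdd v → (∀ x, u x ≤ v x) → M u ≤ M v
  shift : ∀ (k : G) (u : G → ℝ), IsBdd u → M (fun x => u (x + k)) = M u

namespace IsInvariantMean

variable {G : Type*} [AddCommGroup G] {M : (G → ℝ) → ℝ}

theorem sum (hM : IsInvariantMean M) {ι : Type*} (s : Finset ι) {u : ι → G → ℝ}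
    (hu : ∀ i ∈ s, IsBdd (u i)) : M (fun x => ∑ i ∈ s, u i x) = ∑ i ∈ s, M (u i) := by
  classical
  induction s using Finset.induction_on with
  | empty => simpa using hM.const 0
  | insert a s ha ih =>
    have hs : ∀ i ∈ s, IsBdd (u i) := fun i hi => hu i (by simp [hi])
    simp only [Finset.sum_insert ha]
    rw [hM.add _ _ (hu a (by simp)) (IsBdd.sum s hs), ih hs]

theorem isBdd_apply {H : Type*} (hM : IsInvariantMean M) {u : H → G → ℝ}
    (hu : ∃ C, ∀ j x, |u j x| ≤ C) : IsBdd fun j => M (u j) := by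
  obtain ⟨C, hC⟩ := hu
  refine ⟨C, fun j => abs_le.2 ⟨?_, ?_⟩⟩
  · have := hM.mono (fun _ => -C) (u j) (isBdd_const _) ⟨C, hC j⟩ fun x => (abs_le.1 (hC j x)).1
    rwa [hM.const] at this
  · have := hM.mono (u j) (fun _ => C) ⟨C, hC j⟩ (isBdd_const _) fun x => (abs_le.1 (hC j x)).2
    rwa [hM.const] at this

end IsInvariantMean

/-- The Cesàro averages of a bounded function on `ℤ` along `0, 1, 2, …`. -/
noncomputable def cesaro (u : ℤ → ℝ) (n : ℕ) : ℝ := (n : ℝ)⁻¹ * ∑ j ∈ Finset.range n, u j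

theorem abs_cesaro_le {u : ℤ → ℝ} {C : ℝ} (hC : ∀ x, |u x| ≤ C) (n : ℕ) : |cesaro u n| ≤ C := by
  have hC0 : 0 ≤ C := (abs_nonneg _).trans (hC 0)
  rcases Nat.eq_zero_or_pos n with rfl | hn
  · simpa [cesaro] using hC0
  · have hn' : (0 : ℝ) < n := by exact_mod_cast hn
    have h1 : |∑ j ∈ Finset.range n, u j| ≤ n * C := by
      refine (Finset.abs_sum_le_sum_abs _ _).trans ?_
      simpa using Finset.sum_le_sum fun (j : ℕ) (_ : j ∈ Finset.range n) => hC j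
    rw [cesaro, abs_mul, abs_inv, abs_of_pos hn', inv_mul_le_iff₀ hn']
    exact h1

/-- The limit of the Cesàro averages along a nonprincipal ultrafilter. -/
noncomputable def cesaroLim (u : ℤ → ℝ) : ℝ := limUnder (hyperfilter ℕ : Filter ℕ) (cesaro u)

theorem tendsto_cesaro {u : ℤ → ℝ} (hu : IsBdd u) :
    Tendsto (cesaro u) (hyperfilter ℕ : Filter ℕ) (𝓝 (cesaroLim u)) := by
  obtain ⟨C, hC⟩ := hu
  obtain ⟨x, -, hx⟩ := (isCompact_Icc (a := -C) (b := C)).ultrafilter_le_nhds'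
    ((hyperfilter ℕ).map (cesaro u))
    (Filter.Eventually.of_forall (f := (hyperfilter ℕ : Filter ℕ))
      fun n => abs_le.1 (abs_cesaro_le hC n))
  exact tendsto_nhds_limUnder ⟨x, hx⟩

theorem cesaroLim_eq {u : ℤ → ℝ} {c : ℝ}
    (h : Tendsto (cesaro u) (hyperfilter ℕ : Filter ℕ) (𝓝 c)) : cesaroLim u = c :=
  h.limUnder_eq

theorem cesaroLim_succ {u : ℤ → ℝ} (hu : IsBdd u) :
    cesaroLim (fun x => u (x + 1)) = cesaroLim u := by
  obtain ⟨C, hC⟩ := hu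
  apply cesaroLim_eq
  have h1 : Tendsto (fun n : ℕ => (n : ℝ)⁻¹ * (u n - u 0)) (hyperfilter ℕ : Filter ℕ) (𝓝 0) := by
    have h0 : Tendsto (fun n : ℕ => (n : ℝ)⁻¹ * (2 * C)) atTop (𝓝 0) := by
      simpa using (tendsto_inv_atTop_nhds_zero_nat (𝕜 := ℝ)).mul_const (2 * C)
    refine (squeeze_zero_norm (fun n => ?_) h0).mono_left Nat.hyperfilter_le_atTop
    rw [norm_mul, Real.norm_eq_abs, abs_of_nonneg (by positivity : (0 : ℝ) ≤ (n : ℝ)⁻¹)]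
    refine mul_le_mul_of_nonneg_left ?_ (by positivity)
    have h2 := abs_sub (u n) (u 0)
    have h3 := hC n
    have h4 := hC 0
    rw [Real.norm_eq_abs]
    linarith
  have h2 := (tendsto_cesaro ⟨C, hC⟩).add h1
  rw [add_zero] at h2
  refine h2.congr fun n => ?_
  have h3 := Finset.sum_range_sub (fun j : ℕ => u j) n
  rw [Finset.sum_sub_distrib] at h3
  simp only [cesaro, ← mul_add]
  push_cast at h3
  congr 1
  linarith

theorem isInvariantMean_cesaroLim : IsInvariantMean cesaroLim where
  add u v hu hv := cesaroLim_eq <| by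
    refine ((tendsto_cesaro hu).add (tendsto_cesaro hv)).congr fun n => ?_
    simp [cesaro, Finset.sum_add_distrib, mul_add]
  const_mul c u hu := cesaroLim_eq <| by
    refine ((tendsto_cesaro hu).const_mul c).congr fun n => ?_
    simp only [cesaro, ← Finset.mul_sum]
    ring
  const c := cesaroLim_eq <| by
    refine tendsto_const_nhds.congr' ?_
    have h : ∀ᶠ n : ℕ in (hyperfilter ℕ : Filter ℕ), 0 < n :=
      Nat.hyperfilter_le_atTop (eventually_gt_atTop 0)
    filter_upwards [h] with n hn
    have : (n : ℝ) ≠ 0 := by positivity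
    simp [cesaro, this]
  mono u v hu hv h := by
    refine le_of_tendsto_of_tendsto' (tendsto_cesaro hu) (tendsto_cesaro hv) fun n => ?_
    exact mul_le_mul_of_nonneg_left (Finset.sum_le_sum fun j _ => h j) (by positivity)
  shift k u hu := by
    induction k using Int.induction_on with
    | zero => simp
    | succ i ih =>
      rw [← ih, ← cesaroLim_succ (hu.comp fun x => x + i)]
      congr 1; ext x; congr 1; ring
    | pred i ih =>
      rw [← ih, ← cesaroLim_succ (hu.comp fun x => x + (-i - 1))]
      congr 1; ext x; congr 1; ring

theorem exists_isInvariantMean (m : ℕ) : ∃ M : ((Fin m → ℤ) → ℝ) → ℝ, IsInvariantMean M := by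
  induction m with
  | zero =>
    refine ⟨fun u => u 0, ⟨fun _ _ _ _ => rfl, fun _ _ _ => rfl, fun _ => rfl,
      fun _ _ _ _ h => h 0, fun k u _ => ?_⟩⟩
    exact congrArg u (Subsingleton.elim _ _)
  | succ m ih =>
    obtain ⟨M, hM⟩ := ih
    have hin : ∀ {u : (Fin (m + 1) → ℤ) → ℝ}, IsBdd u → ∀ j : ℤ,
        IsBdd fun k : Fin m → ℤ => u (Fin.cons j k) := fun hu j => hu.comp _
    have hout : ∀ {u : (Fin (m + 1) → ℤ) → ℝ}, IsBdd u →
        IsBdd fun j : ℤ => M fun k => u (Fin.cons j k) := fun {u} hu =>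
      hM.isBdd_apply (by obtain ⟨C, hC⟩ := hu; exact ⟨C, fun j x => hC _⟩)
    refine ⟨fun u => cesaroLim fun j => M fun k => u (Fin.cons j k), ?_, ?_, ?_, ?_, ?_⟩
    · intro u v hu hv
      simp only [hM.add _ _ (hin hu _) (hin hv _)]
      exact isInvariantMean_cesaroLim.add _ _ (hout hu) (hout hv)
    · intro c u hu
      simp only [hM.const_mul _ _ (hin hu _)]
      exact isInvariantMean_cesaroLim.const_mul _ _ (hout hu)
    · intro c
      simp only [hM.const]
      exact isInvariantMean_cesaroLim.const c
    · intro u v hu hv h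
      exact isInvariantMean_cesaroLim.mono _ _ (hout hu) (hout hv) fun j =>
        hM.mono _ _ (hin hu j) (hin hv j) fun k => h _
    · intro k u hu
      have h1 : ∀ (j : ℤ) (x : Fin m → ℤ), (Fin.cons j x : Fin (m + 1) → ℤ) + k =
          Fin.cons (j + k 0) (x + Fin.tail k) := by
        intro j x
        ext i
        refine Fin.cases ?_ (fun i => ?_) i <;> simp [Fin.tail]
      simp only [h1]
      have h2 : ∀ j : ℤ, (M fun x => u (Fin.cons (j + k 0) (x + Fin.tail k))) =
          M fun x => u (Fin.cons (j + k 0) x) := fun j =>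
        hM.shift (Fin.tail k) (fun x => u (Fin.cons (j + k 0) x)) (hin hu _)
      simp only [h2]
      exact isInvariantMean_cesaroLim.shift (k 0) (fun j => M fun x => u (Fin.cons j x)) (hout hu)

/-! ### Superharmonic functions of a kernel -/

section Kernel

variable {E : Type*} {P : E → E → ℝ≥0∞}

theorem nStep_superharmonic {t : ℝ≥0∞} {h : E → ℝ≥0∞}
    (hh : ∀ z, ∑' w, P z w * h w ≤ t * h z) (n : ℕ) (z : E) :
    ∑' w, nStep P n z w * h w ≤ t ^ n * h z := by
  classical
  induction n generalizing z with
  | zero =>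
    rw [tsum_eq_single z]
    · simp [nStep]
    · intro w hw; simp [nStep, hw.symm]
  | succ n ih =>
    calc ∑' w, nStep P (n + 1) z w * h w = ∑' w, ∑' v, P z v * (nStep P n v w * h w) := by
          refine tsum_congr fun w => ?_
          simp only [nStep, ← ENNReal.tsum_mul_right, mul_assoc]
      _ = ∑' v, P z v * ∑' w, nStep P n v w * h w := by
          rw [ENNReal.tsum_comm]
          simp only [ENNReal.tsum_mul_left]
      _ ≤ ∑' v, t ^ n * (P z v * h v) := by
          refine ENNReal.tsum_le_tsum fun v => ?_
          calc P z v * ∑' w, nStep P n v w * h w ≤ P z v * (t ^ n * h v) := by gcongr; exact ih v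
            _ = t ^ n * (P z v * h v) := by ring
      _ ≤ t ^ n * (t * h z) := by
          rw [ENNReal.tsum_mul_left]; gcongr; exact hh z
      _ = t ^ (n + 1) * h z := by ring

theorem nStep_mul_le {t : ℝ≥0∞} {h : E → ℝ≥0∞}
    (hh : ∀ z, ∑' w, P z w * h w ≤ t * h z) (n : ℕ) (z w : E) :
    nStep P n z w * h w ≤ t ^ n * h z :=
  (ENNReal.le_tsum w).trans (nStep_superharmonic hh n z)

theorem green_superharmonic {t : ℝ≥0∞} (h0 : t ≠ 0) (ht : t ≠ ∞) (z' z : E) :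
    ∑' w, P z w * green P t w z' ≤ t * green P t z z' := by
  have h1 : ∑' w, P z w * green P t w z' = ∑' n, t⁻¹ ^ n * nStep P (n + 1) z z' := by
    simp only [green, nStep, ← ENNReal.tsum_mul_left]
    rw [ENNReal.tsum_comm]
    exact tsum_congr fun n => tsum_congr fun w => by ring
  have h2 : ∑' n, t⁻¹ ^ (n + 1) * nStep P (n + 1) z z' ≤ green P t z z' :=
    ENNReal.tsum_comp_le_tsum_of_injective (add_left_injective 1)
      fun n => t⁻¹ ^ n * nStep P n z z'
  rw [h1]
  refine le_trans (le_of_eq ?_) (mul_le_mul_right h2 t)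
  rw [← ENNReal.tsum_mul_left]
  refine tsum_congr fun n => ?_
  rw [pow_succ']
  simp only [← mul_assoc]
  rw [ENNReal.mul_inv_cancel h0 ht, one_mul]

theorem green_lt_top_of_superharmonic {s t : ℝ≥0∞} (hst : s < t) {h : E → ℝ≥0∞}
    (hh : ∀ z, ∑' w, P z w * h w ≤ s * h z) (z z' : E) (hz : h z ≠ ∞) (hz' : h z' ≠ 0)
    (hz'' : h z' ≠ ∞) : green P t z z' < ∞ := by
  have h1 : ∀ n, t⁻¹ ^ n * nStep P n z z' ≤ (s / t) ^ n * (h z / h z') := by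
    intro n
    have h2 : nStep P n z z' ≤ s ^ n * h z / h z' :=
      (ENNReal.le_div_iff_mul_le (Or.inl hz') (Or.inl hz'')).2 (nStep_mul_le hh n z z')
    calc t⁻¹ ^ n * nStep P n z z' ≤ t⁻¹ ^ n * (s ^ n * h z / h z') := by gcongr
      _ = (s / t) ^ n * (h z / h z') := by
        simp only [div_eq_mul_inv, mul_pow]; ring
  have h3 : s / t < 1 := ENNReal.div_lt_of_lt_mul (by simpa using hst)
  calc green P t z z' ≤ ∑' n, (s / t) ^ n * (h z / h z') := ENNReal.tsum_le_tsum h1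
    _ = (1 - s / t)⁻¹ * (h z / h z') := by rw [ENNReal.tsum_mul_right, ENNReal.tsum_geometric]
    _ < ∞ := ENNReal.mul_lt_top (by simpa using h3) (ENNReal.div_lt_top hz hz')

variable {G : Type*} [AddCommGroup G] [AddAction G E]

theorem nStep_vadd (hP : ∀ (k : G) z w, P (k +ᵥ z) (k +ᵥ w) = P z w) (k : G) (n : ℕ) (z w : E) :
    nStep P n (k +ᵥ z) (k +ᵥ w) = nStep P n z w := by
  classical
  induction n generalizing z with
  | zero => simp [nStep]
  | succ n ih =>
    simp only [nStep]
    rw [← (AddAction.toPerm k).tsum_eq]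
    exact tsum_congr fun v => by simp [hP, ih]

/-- If a kernel invariant under an abelian group with an invariant mean has a finite Green series
at `t`, then averaging the logarithm of the Green function produces an invariant positive
multiplicative cocycle for which the kernel is `t`-superharmonic. -/
theorem exists_invariant_cocycle {M : (G → ℝ) → ℝ} (hM : IsInvariantMean M)
    (hP : ∀ (k : G) z w, P (k +ᵥ z) (k +ᵥ w) = P z w) (hirr : IsIrreducible P)
    {t : ℝ≥0∞} (h0 : t ≠ 0) (ht : t ≠ ∞) {z₀ z' : E} (hg : green P t z₀ z' < ∞) :
    ∃ c : E → E → ℝ, (∀ z w v, c z w + c w v = c z v) ∧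
      (∀ (k : G) z w, c (k +ᵥ z) (k +ᵥ w) = c z w) ∧
      ∀ z, ∑' w, P z w * ENNReal.ofReal (Real.exp (c z w)) ≤ t := by
  set h : E → ℝ≥0∞ := fun z => green P t z z' with hdef
  have hh : ∀ z, ∑' w, P z w * h w ≤ t * h z := green_superharmonic h0 ht z'
  have hpos : ∀ z, h z ≠ 0 := by
    intro z hz
    obtain ⟨n, hn⟩ := hirr z z'
    have h1 := ENNReal.tsum_eq_zero.1 hz n
    rcases mul_eq_zero.1 h1 with h2 | h2
    · exact pow_ne_zero n (ENNReal.inv_ne_zero.2 ht) h2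
    · exact hn.ne' h2
  have hfin : ∀ z, h z ≠ ∞ := by
    intro z hz
    obtain ⟨n, hn⟩ := hirr z₀ z
    have h1 := nStep_mul_le hh n z₀ z
    rw [hz, ENNReal.mul_top hn.ne', top_le_iff] at h1
    exact ENNReal.mul_ne_top (ENNReal.pow_ne_top ht) hg.ne h1
  have hPfin : ∀ n z w, nStep P n z w ≠ ∞ := by
    intro n z w hz
    have h1 := nStep_mul_le hh n z w
    rw [hz, ENNReal.top_mul (hpos w), top_le_iff] at h1
    exact ENNReal.mul_ne_top (ENNReal.pow_ne_top ht) (hfin z) h1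
  have hP1 : ∀ z w, P z w ≠ ∞ := by
    intro z w hz
    have h1 := (ENNReal.le_tsum w).trans (hh z)
    rw [hz, ENNReal.top_mul (hpos w), top_le_iff] at h1
    exact ENNReal.mul_ne_top ht (hfin z) h1
  set l : E → ℝ := fun z => Real.log (h z).toReal with hl
  have hhpos : ∀ z, 0 < (h z).toReal := fun z => ENNReal.toReal_pos (hpos z) (hfin z)
  have htpos : 0 < t.toReal := ENNReal.toReal_pos h0 ht
  have hexp : ∀ z w, Real.exp (l w - l z) = (h w).toReal / (h z).toReal := by
    intro z w
    rw [Real.exp_sub, Real.exp_log (hhpos w), Real.exp_log (hhpos z)]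
  have hup : ∀ z w, ∃ C, ∀ k : G, l (k +ᵥ w) - l (k +ᵥ z) ≤ C := by
    intro z w
    obtain ⟨n, hn⟩ := hirr z w
    have hp : 0 < (nStep P n z w).toReal := ENNReal.toReal_pos hn.ne' (hPfin n z w)
    refine ⟨Real.log (t.toReal ^ n / (nStep P n z w).toReal), fun k => ?_⟩
    rw [Real.le_log_iff_exp_le (by positivity), hexp, div_le_div_iff₀ (hhpos _) hp]
    have h1 := nStep_mul_le hh n (k +ᵥ z) (k +ᵥ w)
    rw [nStep_vadd hP] at h1
    have h2 := ENNReal.toReal_mono (ENNReal.mul_ne_top (ENNReal.pow_ne_top ht) (hfin _)) h1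
    rw [ENNReal.toReal_mul, ENNReal.toReal_mul, ENNReal.toReal_pow] at h2
    linarith
  have hbdd : ∀ z w, IsBdd fun k : G => l (k +ᵥ w) - l (k +ᵥ z) := by
    intro z w
    obtain ⟨C, hC⟩ := hup z w
    obtain ⟨D, hD⟩ := hup w z
    refine ⟨max C D, fun k => abs_le.2 ⟨?_, (hC k).trans (le_max_left _ _)⟩⟩
    have h1 := hD k
    have h2 := le_max_right C D
    linarith
  refine ⟨fun z w => M fun k => l (k +ᵥ w) - l (k +ᵥ z), ?_, ?_, ?_⟩
  · intro z w v
    simp only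
    rw [← hM.add _ _ (hbdd z w) (hbdd w v)]
    congr 1; ext k; ring
  · intro k z w
    simp only [← add_vadd]
    exact hM.shift k _ (hbdd z w)
  · intro z
    rw [ENNReal.tsum_eq_iSup_sum]
    refine iSup_le fun F => ?_
    set c : E → ℝ := fun w => M fun k => l (k +ᵥ w) - l (k +ᵥ z) with hc
    have hB : ∀ w, IsBdd fun k : G => (P z w).toReal * Real.exp (c w) *
        ((l (k +ᵥ w) - l (k +ᵥ z)) + (1 - c w)) := fun w =>
      ((hbdd z w).add (isBdd_const _)).const_mul _
    have h1 : ∀ k : G, ∑ w ∈ F, (P z w).toReal * Real.exp (c w) *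
        ((l (k +ᵥ w) - l (k +ᵥ z)) + (1 - c w)) ≤ t.toReal := by
      intro k
      have h2 : ∀ w, (P z w).toReal * Real.exp (c w) * ((l (k +ᵥ w) - l (k +ᵥ z)) + (1 - c w)) ≤
          (P z w).toReal * ((h (k +ᵥ w)).toReal / (h (k +ᵥ z)).toReal) := by
        intro w
        rw [← hexp, mul_assoc]
        refine mul_le_mul_of_nonneg_left ?_ ENNReal.toReal_nonneg
        have h3 := Real.add_one_le_exp (l (k +ᵥ w) - l (k +ᵥ z) - c w)
        have h4 : Real.exp (l (k +ᵥ w) - l (k +ᵥ z)) =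
            Real.exp (c w) * Real.exp (l (k +ᵥ w) - l (k +ᵥ z) - c w) := by
          rw [← Real.exp_add]; congr 1; ring
        rw [h4]
        exact mul_le_mul_of_nonneg_left (by linarith) (Real.exp_pos _).le
      refine (Finset.sum_le_sum fun w _ => h2 w).trans ?_
      have h3 : ∑ w ∈ F, P z w * h (k +ᵥ w) ≤ t * h (k +ᵥ z) := by
        refine le_trans ?_ (hh (k +ᵥ z))
        rw [← (AddAction.toPerm k).tsum_eq]
        simp only [AddAction.toPerm_apply, hP]
        exact ENNReal.sum_le_tsum F
      have h4 := ENNReal.toReal_mono (ENNReal.mul_ne_top ht (hfin _)) h3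
      rw [ENNReal.toReal_sum fun w _ => ENNReal.mul_ne_top (hP1 z w) (hfin _),
        ENNReal.toReal_mul] at h4
      simp only [ENNReal.toReal_mul] at h4
      simp only [mul_div_assoc', ← Finset.sum_div]
      rwa [div_le_iff₀ (hhpos _)]
    have h2 := hM.mono _ _ (IsBdd.sum F fun w _ => hB w) (isBdd_const _) h1
    rw [hM.const, hM.sum F fun w _ => hB w] at h2
    have h3 : ∀ w, (M fun k : G => (P z w).toReal * Real.exp (c w) *
        ((l (k +ᵥ w) - l (k +ᵥ z)) + (1 - c w))) = (P z w).toReal * Real.exp (c w) := by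
      intro w
      rw [hM.const_mul _ _ ((hbdd z w).add (isBdd_const _)),
        hM.add _ _ (hbdd z w) (isBdd_const _), hM.const]
      change _ * (c w + (1 - c w)) = _
      ring
    simp only [h3] at h2
    rw [← ENNReal.ofReal_toReal ht]
    refine le_trans (le_of_eq ?_) (ENNReal.ofReal_le_ofReal h2)
    rw [ENNReal.ofReal_sum_of_nonneg fun w _ => by positivity]
    refine Finset.sum_congr rfl fun w _ => ?_
    rw [ENNReal.ofReal_mul ENNReal.toReal_nonneg, ENNReal.ofReal_toReal (hP1 z w)]

end Kernel

/-! ### The walk on the half-space -/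

section HalfSpace

variable {m : ℕ} {μ μ₀ : Measure (Lattice m)}

/-- Horizontal translations of the half-space. -/
instance : AddAction (Fin m → ℤ) (HalfSpace m) where
  vadd k z := (k + z.1, z.2)
  zero_vadd z := Prod.ext (zero_add z.1) rfl
  add_vadd k l z := Prod.ext (add_assoc k l z.1) rfl

theorem vadd_def (k : Fin m → ℤ) (z : HalfSpace m) : k +ᵥ z = (k + z.1, z.2) := rfl

theorem kernel_vadd (k : Fin m → ℤ) (z w : HalfSpace m) :
    kernel μ μ₀ (k +ᵥ z) (k +ᵥ w) = kernel μ μ₀ z w := by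
  have h : HalfSpace.toLattice (k +ᵥ w) - HalfSpace.toLattice (k +ᵥ z) =
      HalfSpace.toLattice w - HalfSpace.toLattice z := by
    simp [HalfSpace.toLattice, vadd_def]
  simp only [kernel, h]
  rfl

theorem toLattice_injective : Function.Injective (HalfSpace.toLattice (m := m)) := by
  rintro ⟨x, y⟩ ⟨x', y'⟩ h
  simpa [HalfSpace.toLattice] using h

theorem tsum_jump {ν : Measure (Lattice m)} (z : HalfSpace m)
    (hν : ∀ v : Lattice m, v.2 + z.2 < 0 → ν {v} = 0) (F : Lattice m → ℝ≥0∞) :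
    ∑' w : HalfSpace m, ν {w.toLattice - z.toLattice} * F (w.toLattice - z.toLattice) =
      ∑' v : Lattice m, ν {v} * F v := by
  have hinj : Function.Injective fun w : HalfSpace m => w.toLattice - z.toLattice :=
    (sub_left_injective).comp toLattice_injective
  refine hinj.tsum_eq (f := fun v => ν {v} * F v) fun v hv => ?_
  have h1 : 0 ≤ v.2 + z.2 := by
    by_contra hlt
    exact hv (by simp [hν v (not_le.1 hlt)])
  refine ⟨(v.1 + z.1, (v.2 + z.2).toNat), ?_⟩
  refine Prod.ext ?_ ?_
  · simp [HalfSpace.toLattice]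
  · simp [HalfSpace.toLattice, Int.toNat_of_nonneg h1]

theorem tsum_kernel_of_pos (H0 : ∀ z : Lattice m, z.2 < -1 → μ {z} = 0) {z : HalfSpace m}
    (hz : 0 < z.2) (F : Lattice m → ℝ≥0∞) :
    ∑' w : HalfSpace m, kernel μ μ₀ z w * F (w.toLattice - z.toLattice) =
      ∑' v : Lattice m, μ {v} * F v := by
  simp only [kernel, if_pos hz]
  exact tsum_jump z (fun v hv => H0 v (by omega)) F

theorem tsum_kernel_of_zero (H0' : ∀ z : Lattice m, z.2 < 0 → μ₀ {z} = 0) {z : HalfSpace m}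
    (hz : z.2 = 0) (F : Lattice m → ℝ≥0∞) :
    ∑' w : HalfSpace m, kernel μ μ₀ z w * F (w.toLattice - z.toLattice) =
      ∑' v : Lattice m, μ₀ {v} * F v := by
  simp only [kernel, hz, lt_irrefl, if_false]
  exact tsum_jump z (fun v hv => H0' v (by omega)) F

theorem dot_sub (a : (Fin m → ℝ) × ℝ) (v w : Lattice m) : dot a (v - w) = dot a v - dot a w := by
  simp only [dot, Prod.fst_sub, Prod.snd_sub, Pi.sub_apply, Int.cast_sub, mul_sub,
    Finset.sum_sub_distrib]
  ring

theorem exp_superharmonic (H0 : ∀ z : Lattice m, z.2 < -1 → μ {z} = 0)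
    (H0' : ∀ z : Lattice m, z.2 < 0 → μ₀ {z} = 0) (a : (Fin m → ℝ) × ℝ) (z : HalfSpace m) :
    ∑' w : HalfSpace m, kernel μ μ₀ z w * ENNReal.ofReal (Real.exp (dot a w.toLattice)) ≤
      max (jumpGen μ a) (jumpGen μ₀ a) * ENNReal.ofReal (Real.exp (dot a z.toLattice)) := by
  have h1 : ∀ w : HalfSpace m,
      kernel μ μ₀ z w * ENNReal.ofReal (Real.exp (dot a w.toLattice)) =
      kernel μ μ₀ z w * ENNReal.ofReal (Real.exp (dot a (w.toLattice - z.toLattice))) *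
        ENNReal.ofReal (Real.exp (dot a z.toLattice)) := by
    intro w
    rw [mul_assoc, ← ENNReal.ofReal_mul (Real.exp_pos _).le, ← Real.exp_add, dot_sub,
      sub_add_cancel]
  simp only [h1]
  rw [ENNReal.tsum_mul_right]
  refine mul_le_mul_left ?_ _
  rcases Nat.eq_zero_or_pos z.2 with hz | hz
  · rw [tsum_kernel_of_zero H0' hz fun v => ENNReal.ofReal (Real.exp (dot a v))]
    exact le_max_right _ _
  · rw [tsum_kernel_of_pos H0 hz fun v => ENNReal.ofReal (Real.exp (dot a v))]
    exact le_max_left _ _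

theorem convergenceNorm_le (H0 : ∀ z : Lattice m, z.2 < -1 → μ {z} = 0)
    (H0' : ∀ z : Lattice m, z.2 < 0 → μ₀ {z} = 0) (a : (Fin m → ℝ) × ℝ) (z z' : HalfSpace m) :
    convergenceNorm (kernel μ μ₀) z z' ≤ max (jumpGen μ a) (jumpGen μ₀ a) := by
  refine le_of_forall_gt_imp_ge_of_dense fun t ht => ?_
  rcases eq_or_ne t ∞ with rfl | htop
  · exact le_top
  · refine sInf_le ⟨bot_le.trans_lt ht, htop.lt_top, ?_⟩
    exact green_lt_top_of_superharmonic ht (exp_superharmonic H0 H0' a) z z'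
      ENNReal.ofReal_ne_top (by simpa using Real.exp_pos _) ENNReal.ofReal_ne_top

theorem exists_down_jump (H0 : ∀ z : Lattice m, z.2 < -1 → μ {z} = 0)
    (H2 : IsIrreducible (homogeneousKernel μ)) : ∃ x : Fin m → ℤ, μ {(x, -1)} ≠ 0 := by
  by_contra! hx
  have hdown : ∀ v : Lattice m, v.2 < 0 → μ {v} = 0 := by
    rintro ⟨x, y⟩ hy
    rcases (show y = -1 ∨ y < -1 by simp at hy; omega) with rfl | h
    · exact hx x
    · exact H0 _ h
  have hn : ∀ (n : ℕ) (z w : Lattice m), w.2 < z.2 → nStep (homogeneousKernel μ) n z w = 0 := by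
    intro n
    induction n with
    | zero =>
      intro z w hzw
      have : z ≠ w := by rintro rfl; exact lt_irrefl _ hzw
      simp [nStep, this]
    | succ n ih =>
      intro z w hzw
      simp only [nStep, ENNReal.tsum_eq_zero]
      intro v
      rcases lt_or_ge v.2 z.2 with h | h
      · simp [homogeneousKernel, hdown (v - z) (by simpa using h)]
      · rw [ih v w (hzw.trans_le h), mul_zero]
  obtain ⟨n, h⟩ := H2 (0, 0) (0, -1)
  exact h.ne' (hn n _ _ (by simp))

theorem additive_eq_sum {A : (Fin m → ℤ) → ℝ} (hA : ∀ s s', A (s + s') = A s + A s')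
    (s : Fin m → ℤ) : A s = ∑ i, A (Pi.single i 1) * (s i : ℝ) := by
  let f : (Fin m → ℤ) →+ ℝ := AddMonoidHom.mk' A hA
  have h : f s = f (∑ i, s i • Pi.single i 1) := by
    congr 1
    simpa using pi_eq_sum_univ' s
  change f s = _
  rw [h, map_sum]
  refine Finset.sum_congr rfl fun i _ => ?_
  rw [map_zsmul, zsmul_eq_mul, mul_comm]
  rfl

theorem exists_exponent (H0 : ∀ z : Lattice m, z.2 < -1 → μ {z} = 0)
    (H0' : ∀ z : Lattice m, z.2 < 0 → μ₀ {z} = 0) (H1 : IsIrreducible (kernel μ μ₀))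
    (H2 : IsIrreducible (homogeneousKernel μ)) {t : ℝ≥0∞} (h0 : t ≠ 0) (ht : t ≠ ∞)
    {z z' : HalfSpace m} (hg : green (kernel μ μ₀) t z z' < ∞) :
    ∃ a : (Fin m → ℝ) × ℝ, jumpGen μ a ≤ t ∧ jumpGen μ₀ a ≤ t := by
  obtain ⟨M, hM⟩ := exists_isInvariantMean m
  obtain ⟨c, hadd, hinv, hsup⟩ := exists_invariant_cocycle hM kernel_vadd H1 h0 ht hg
  set A : (Fin m → ℤ) → ℝ := fun s => c (0, 0) (s, 0) with hAdef
  set g : ℕ → ℝ := fun y => c (0, 0) (0, y) with hgdef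
  have hinv' : ∀ (s x x' : Fin m → ℤ) (y y' : ℕ), c (s + x, y) (s + x', y') = c (x, y) (x', y') :=
    fun s x x' y y' => hinv s (x, y) (x', y')
  have hA : ∀ s s', A (s + s') = A s + A s' := by
    intro s s'
    have h1 := hinv' s 0 s' 0 0
    have h2 := hadd (0, 0) (s, 0) (s + s', 0)
    rw [add_zero] at h1
    simp only [hAdef]
    linarith
  have hc : ∀ (s : Fin m → ℤ) (y y' : ℕ), c (0, y) (s, y') = A s + g y' - g y := by
    intro s y y'
    have h1 := hinv' s 0 0 0 y'
    rw [add_zero] at h1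
    have h2 := hadd (0, 0) (s, 0) (s, y')
    have h3 := hadd (0, 0) (0, y) (s, y')
    simp only [hAdef, hgdef]
    linarith
  obtain ⟨x₁, hx₁⟩ := exists_down_jump H0 H2
  have hterm : ∀ y : ℕ, μ {(x₁, -1)} * ENNReal.ofReal (Real.exp (A x₁ + g y - g (y + 1))) ≤ t := by
    intro y
    have h1 := (ENNReal.le_tsum (x₁, y)).trans (hsup (0, y + 1))
    rw [hc] at h1
    simpa [kernel, HalfSpace.toLattice] using h1
  have hfin₁ : μ {(x₁, -1)} ≠ ∞ := by
    intro h
    have h1 := hterm 0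
    rw [h, ENNReal.top_mul (by simpa using Real.exp_pos _), top_le_iff] at h1
    exact ht h1
  have hbelow : BddBelow (Set.range fun y : ℕ => g (y + 1) - g y) := by
    refine ⟨A x₁ - Real.log (t.toReal / (μ {(x₁, -1)}).toReal), ?_⟩
    rintro _ ⟨y, rfl⟩
    have hp : 0 < (μ {(x₁, -1)}).toReal := ENNReal.toReal_pos hx₁ hfin₁
    have htp : 0 < t.toReal := ENNReal.toReal_pos h0 ht
    have h1 := ENNReal.toReal_mono ht (hterm y)
    rw [ENNReal.toReal_mul, ENNReal.toReal_ofReal (Real.exp_pos _).le, mul_comm,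
      ← le_div_iff₀ hp, ← Real.le_log_iff_exp_le (by positivity)] at h1
    simp only
    linarith
  set β : ℝ := ⨅ y : ℕ, (g (y + 1) - g y) with hβ
  have hstep : ∀ y, β ≤ g (y + 1) - g y := fun y => ciInf_le hbelow y
  have hgrow : ∀ y n : ℕ, g y + β * n ≤ g (y + n) := by
    intro y n
    induction n with
    | zero => simp
    | succ n ih =>
      have h1 := hstep (y + n)
      push_cast
      rw [← add_assoc y n 1]
      linarith
  have hdot : ∀ v : Lattice m, dot (fun i => A (Pi.single i 1), β) v = A v.1 + β * v.2 := by
    intro v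
    rw [additive_eq_sum hA v.1]
    rfl
  refine ⟨(fun i => A (Pi.single i 1), β), ?_, ?_⟩
  · have hy : ∀ y : ℕ, jumpGen μ (fun i => A (Pi.single i 1), β) *
        ENNReal.ofReal (Real.exp (β - (g (y + 1) - g y))) ≤ t := by
      intro y
      refine le_trans (le_of_eq ?_) ((ENNReal.tsum_le_tsum
        (f := fun w : HalfSpace m => kernel μ μ₀ (0, y + 1) w *
          (ENNReal.ofReal (Real.exp (dot (fun i => A (Pi.single i 1), β)
            (w.toLattice - HalfSpace.toLattice (0, y + 1)))) *
          ENNReal.ofReal (Real.exp (β - (g (y + 1) - g y))))) fun w => ?_).trans (hsup (0, y + 1)))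
      · rw [tsum_kernel_of_pos H0 (Nat.succ_pos y) fun v =>
          ENNReal.ofReal (Real.exp (dot (fun i => A (Pi.single i 1), β) v)) *
          ENNReal.ofReal (Real.exp (β - (g (y + 1) - g y)))]
        simp only [← mul_assoc]
        rw [ENNReal.tsum_mul_right]
        rfl
      · obtain ⟨x, j⟩ := w
        rw [← ENNReal.ofReal_mul (Real.exp_pos _).le, ← Real.exp_add, hdot, hc]
        rcases lt_or_ge j y with hj | hj
        · have : kernel μ μ₀ (0, y + 1) (x, j) = 0 := by
            simp only [kernel, Nat.succ_pos, if_true]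
            exact H0 _ (by simp [HalfSpace.toLattice]; omega)
          simp [this]
        · obtain ⟨n, rfl⟩ := Nat.exists_eq_add_of_le hj
          refine mul_le_mul_right (ENNReal.ofReal_le_ofReal (Real.exp_le_exp.2 ?_)) _
          have h1 := hgrow y n
          simp only [HalfSpace.toLattice, Prod.mk_sub_mk, sub_zero]
          push_cast
          linarith
    have hδ : ∀ δ : ℝ, 0 < δ →
        jumpGen μ (fun i => A (Pi.single i 1), β) * ENNReal.ofReal (Real.exp (-δ)) ≤ t := by
      intro δ hδ
      obtain ⟨y, hy'⟩ := exists_lt_of_ciInf_lt (show β < β + δ by linarith)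
      exact (mul_le_mul_right (ENNReal.ofReal_le_ofReal (Real.exp_le_exp.2 (by linarith))) _).trans
        (hy y)
    have hlim : Tendsto (fun δ : ℝ => jumpGen μ (fun i => A (Pi.single i 1), β) *
        ENNReal.ofReal (Real.exp (-δ))) (𝓝[>] 0) (𝓝 (jumpGen μ (fun i => A (Pi.single i 1), β))) := by
      have h1 : Tendsto (fun δ : ℝ => ENNReal.ofReal (Real.exp (-δ))) (𝓝[>] 0) (𝓝 1) := by
        have h2 : Continuous fun δ : ℝ => ENNReal.ofReal (Real.exp (-δ)) :=
          ENNReal.continuous_ofReal.comp (by fun_prop)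
        simpa using (h2.tendsto 0).mono_left nhdsWithin_le_nhds
      simpa using ENNReal.Tendsto.const_mul h1 (Or.inl one_ne_zero)
    exact le_of_tendsto hlim (eventually_mem_nhdsWithin.mono fun δ h => hδ δ h)
  · refine le_trans (le_of_eq ?_) ((ENNReal.tsum_le_tsum
      (f := fun w : HalfSpace m => kernel μ μ₀ (0, 0) w *
        ENNReal.ofReal (Real.exp (dot (fun i => A (Pi.single i 1), β)
          (w.toLattice - HalfSpace.toLattice (0, 0))))) fun w => ?_).trans (hsup (0, 0)))
    · rw [tsum_kernel_of_zero H0' rfl fun v =>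
          ENNReal.ofReal (Real.exp (dot (fun i => A (Pi.single i 1), β) v))]
      rfl
    · obtain ⟨x, j⟩ := w
      rw [hdot, hc]
      refine mul_le_mul_right (ENNReal.ofReal_le_ofReal (Real.exp_le_exp.2 ?_)) _
      have h1 := hgrow 0 j
      rw [zero_add] at h1
      simp only [HalfSpace.toLattice, Prod.mk_sub_mk, sub_zero]
      push_cast
      linarith

end HalfSpace

end HalfSpaceWalk

theorem proposition1 (m : ℕ)
    (μ μ₀ : MeasureTheory.Measure (HalfSpaceWalk.Lattice m))
    (hμ_pos : 0 < μ Set.univ) (hμ_le : μ Set.univ ≤ 1)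
    (hμ₀_pos : 0 < μ₀ Set.univ) (hμ₀_le : μ₀ Set.univ ≤ 1)
    (H0 : ∀ z : HalfSpaceWalk.Lattice m, z.2 < -1 → μ {z} = 0)
    (H0' : ∀ z : HalfSpaceWalk.Lattice m, z.2 < 0 → μ₀ {z} = 0)
    (H1 : HalfSpaceWalk.IsIrreducible (HalfSpaceWalk.kernel μ μ₀))
    (H2 : HalfSpaceWalk.IsIrreducible (HalfSpaceWalk.homogeneousKernel μ))
    (H3 : ∀ a : (Fin m → ℝ) × ℝ, HalfSpaceWalk.jumpGen μ a < ∞)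
    (H3' : ∀ a : (Fin m → ℝ) × ℝ, HalfSpaceWalk.jumpGen μ₀ a < ∞) :
    ∀ z z' : HalfSpaceWalk.HalfSpace m,
      HalfSpaceWalk.convergenceNorm (HalfSpaceWalk.kernel μ μ₀) z z' =
        ⨅ a : (Fin m → ℝ) × ℝ,
          max (HalfSpaceWalk.jumpGen μ a) (HalfSpaceWalk.jumpGen μ₀ a) := by
  intro z z'
  refine le_antisymm (le_iInf fun a => HalfSpaceWalk.convergenceNorm_le H0 H0' a z z') ?_
  refine le_sInf fun t ht => ?_
  obtain ⟨a, h1, h2⟩ := HalfSpaceWalk.exists_exponent H0 H0' H1 H2 ht.1.ne' ht.2.1.ne ht.2.2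
  exact (iInf_le _ a).trans (max_le h1 h2)
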